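/- Let $\lambda\in(-\tfrac32,-\tfrac12)$, $\lambda\neq-1$, and let $C_m=C_m^\lambda$ ($m\ge 0$) be the monic ultraspherical polynomials, defined by $C_0(x)=1$, $C_1(x)=x$ and $$C_m(x)=xC_{m-1}(x)-b_mC_{m-2}(x),\qquad b_m=\frac{(m-1)(m-2+2\lambda)}{4(m-2+\lambda)(m-1+\lambda)}\qquad(m\ge2).$$ Fix $n\ge5$ and $\varepsilon>0$. Then $C_{n-2}$ has a largest real zero $x_{n-2,n-2}$, and $x_{n-2,n-2}>1$. Put $a_n=x_{n-2,n-2}+\varepsilon$. Define monic polynomials $D_m$ $(m\ge 0)$ as follows: $$D_n(x)=(x^2-1)C_{n-2}(x),\qquad D_{n-1}(x)=C_{n-1}(x),$$ $$D_{n-j}(x)=-\frac1{\ell_{n-j+2}}\bigl[D_{n-j+2}(x)-xD_{n-j+1}(x)\bigr]\quad(j=2,\dots,n),$$ $$D_{n+j}(x)=xD_{n+j-1}(x)-\ell_{n+j}D_{n+j-2}(x)\quad(j=1,2,\dots),$$ where $\ell_m=\beta_{2,m-1}-\beta_{2,m}$ for $2\le m\le n$, $\beta_{2,m}$ being the coefficient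 of $x^{m-2}$ in $D_m$ (and $\beta_{2,1}=0$), and where the $\ell_{n+j}$, $j\ge1$, are chosen one after the other, arbitrarily subject to $$\ell_{n+j}\in\Bigl(0,\ \frac{a_nD_{n+j-1}(a_n)}{D_{n+j-2}(a_n)}\Bigr).$$ Then: 1. At every step the upper bound $a_nD_{n+j-1}(a_n)/D_{n+j-2}(a_n)$ is positive, so such choices are possible; and $\ell_m>0$ for $2\le m\le n$. 2. For every such choice, each $D_m$ is monic of degree $m$ and $D_m(-x)=(-1)^mD_m(x)$ (the sequence is symmetric). 3. For every such choice, $\{D_m\}_{m=0}^\infty$ is orthogonal with respect to a positive measure supported on the closed interval $[-a_n,a_n]$: there is a positive measure $\mu$ on $\mathbb R$ with all moments finite and $\mu(\mathbb R\setminus[-a_n,a_n])=0$ such that $\int D_iD_j\,d\mu=0$ for $i\ne j$ and $\int D_i^2\,d\mu>0$ for all $i$. 4. For every such choice, all the (complex) zeros of every $D_m$, $m\ge 0$, are real and lie in the open interval $(-a_n,a_n)$. -/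

import Mathlib

open Polynomial MeasureTheory

noncomputable section

/-- The recurrence coefficient `b_m = (m-1)(m-2+2λ) / (4(m-2+λ)(m-1+λ))` of the monic
ultraspherical polynomials. -/
def ultrasphericalCoeff (lam : ℝ) (m : ℕ) : ℝ :=
  (((m : ℝ) - 1) * ((m : ℝ) - 2 + 2 * lam)) /
    (4 * ((m : ℝ) - 2 + lam) * ((m : ℝ) - 1 + lam))

/-- The monic ultraspherical polynomial `C_m^λ`: `C_0 = 1` and `C_m = x C_{m-1} - b_m C_{m-2}`
for `m ≥ 1`, where `C_{-1} = 0` (so that `C_1 = x`). -/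
def ultraspherical (lam : ℝ) : ℕ → ℝ[X]
  | 0 => 1
  | 1 => X
  | m + 2 => X * ultraspherical lam (m + 1)
      - C (ultrasphericalCoeff lam (m + 2)) * ultraspherical lam m

/-- The largest real zero of a polynomial (meaningful when there is one: the set of real zeros
of a nonzero polynomial is finite, so that its supremum is then a maximum). -/
def largestZero (P : ℝ[X]) : ℝ := sSup {x : ℝ | P.IsRoot x}

/-- The coefficient of `x^(m-2)` in `P` (intended for `P` of degree `m`); it is `0` if `m < 2`,
there being no negative powers. -/
def subsubleadingCoeff (m : ℕ) (P : ℝ[X]) : ℝ := if 2 ≤ m then P.coeff (m - 2) else 0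

/-- The backward recurrence; `wendroffBackward n lam k` is `D_{n-k}` for `k ≤ n`:
`D_n = (x² - 1) C_{n-2}`, `D_{n-1} = C_{n-1}` and
`D_{n-k-2} = -(1/ℓ_{n-k}) (D_{n-k} - x D_{n-k-1})`, where `ℓ_{n-k}` is the coefficient of
`x^(n-k-3)` in `D_{n-k-1}` minus the coefficient of `x^(n-k-2)` in `D_{n-k}`. -/
def wendroffBackward (n : ℕ) (lam : ℝ) : ℕ → ℝ[X]
  | 0 => (X ^ 2 - 1) * ultraspherical lam (n - 2)
  | 1 => ultraspherical lam (n - 1)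
  | k + 2 =>
      -C (1 / (subsubleadingCoeff (n - k - 1) (wendroffBackward n lam (k + 1))
          - subsubleadingCoeff (n - k) (wendroffBackward n lam k)))
        * (wendroffBackward n lam k - X * wendroffBackward n lam (k + 1))

/-- The forward recurrence; `wendroffForward n lam ℓ k` is `D_{n+k}`:
`D_{n+k} = x D_{n+k-1} - ℓ_{n+k} D_{n+k-2}` for `k ≥ 1`, starting from
`D_n = (x² - 1) C_{n-2}` and `D_{n-1} = C_{n-1}`. -/
def wendroffForward (n : ℕ) (lam : ℝ) (ℓ : ℕ → ℝ) : ℕ → ℝ[X]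
  | 0 => (X ^ 2 - 1) * ultraspherical lam (n - 2)
  | 1 => X * ((X ^ 2 - 1) * ultraspherical lam (n - 2))
      - C (ℓ (n + 1)) * ultraspherical lam (n - 1)
  | k + 2 => X * wendroffForward n lam ℓ (k + 1)
      - C (ℓ (n + k + 2)) * wendroffForward n lam ℓ k

/-- The sequence `D_0, D_1, D_2, …` generated by `D_n = (x² - 1) C_{n-2}^λ` and
`D_{n-1} = C_{n-1}^λ`. Only the values `ℓ m` with `m > n`, the freely chosen forward
coefficients, are used. -/
def wendroffSeq (n : ℕ) (lam : ℝ) (ℓ : ℕ → ℝ) (m : ℕ) : ℝ[X] :=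
  if m < n then wendroffBackward n lam (n - m) else wendroffForward n lam ℓ (m - n)

/-- `ℓ_{n+j}` lies in the open interval `(0, a D_{n+j-1}(a) / D_{n+j-2}(a))`. -/
def AdmissibleAt (n : ℕ) (lam a : ℝ) (ℓ : ℕ → ℝ) (j : ℕ) : Prop :=
  ℓ (n + j) ∈ Set.Ioo (0 : ℝ)
    (a * (wendroffSeq n lam ℓ (n + j - 1)).eval a / (wendroffSeq n lam ℓ (n + j - 2)).eval a)

/-- `P_0, P_1, …` is a sequence of monic polynomials, `P_m` of degree `m`, that is orthogonal
with respect to the (positive) measure `μ`. Integrability of the products `P_i P_j` amounts to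
finiteness of all moments of `μ`. -/
structure IsMonicOrthogonal (P : ℕ → ℝ[X]) (μ : Measure ℝ) : Prop where
  monic : ∀ m, (P m).Monic
  natDegree_eq : ∀ m, (P m).natDegree = m
  integrable_mul : ∀ i j, Integrable (fun x => (P i).eval x * (P j).eval x) μ
  orthogonal : ∀ i j, i ≠ j → ∫ x, (P i).eval x * (P j).eval x ∂μ = 0
  norm_pos : ∀ i, 0 < ∫ x, (P i).eval x * (P i).eval x ∂μ

end

/-!
For `λ ∈ (-3/2, -1/2)` the recurrence coefficients of `C_m` are not all positive, but `λ + 1`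
is in the classical range. The connection formula `C_{m+2}^λ = x C_{m+1}^{λ+1} - d_m C_m^{λ+1}` with
`d_m ≥ 0` for `m ≥ 1` makes `C_{m+2}^λ` a Hermite–Biehler combination, so its zeros are real, and
`C_{m+2}^λ(1) < 0` pushes the largest one beyond `1`. By the first-order differential relation for
`C_{n-2}`, the derivative of `D_n = (x² - 1) C_{n-2}` and `D_{n-1} = C_{n-1}` have the same sign at
the zeros of `D_n`. The reciprocals of the products of these values are therefore the weights of a
positive Gauss quadrature for which `D_n` and `D_{n-1}` are orthogonal. The backward recurrence
yields its lower orthogonal polynomials, hence `ℓ_m > 0` for `m ≤ n`, and `D_m(a_n) > 0` because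
the nodes lie below `a_n`.

The upper bound on `ℓ_{n+j}` says exactly that `D_{n+j}(a_n) > 0`. So all recurrence coefficients
and all values `D_m(a_n)` are positive, which confines the zeros to `(-a_n, a_n)`, and a weak
limit of the Gauss quadratures at the zeros of `D_m` is the orthogonality measure.
-/

open scoped ComplexConjugate

/-- `p (-x) = (-1) ^ k * p x`, that is, `p` is even or odd according to the parity of `k`. -/
def HasParity {R : Type*} [CommRing R] (k : ℕ) (p : R[X]) : Prop :=
  p.comp (-X) = (-1) ^ k * p

namespace HasParity

variable {R : Type*} [CommRing R] {k : ℕ} {p q : R[X]}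

lemma sub (hp : HasParity k p) (hq : HasParity k q) : HasParity k (p - q) := by
  rw [HasParity, sub_comp, hp, hq, mul_sub]

lemma C_mul (hp : HasParity k p) (c : R) : HasParity k (C c * p) := by
  rw [HasParity, mul_comp, C_comp, hp, mul_left_comm]

lemma X_mul (hp : HasParity k p) : HasParity (k + 1) (X * p) := by
  rw [HasParity, mul_comp, X_comp, hp]
  ring

lemma add_two (hp : HasParity k p) : HasParity (k + 2) p := by
  rw [HasParity, hp, pow_add, neg_one_sq, mul_one]

lemma eval_neg (hp : HasParity k p) (x : R) : p.eval (-x) = (-1) ^ k * p.eval x := by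
  simpa [eval_comp] using congrArg (eval x) hp

lemma coeff_eq_zero [IsAddTorsionFree R] (hp : HasParity k p) {j : ℕ} (hj : Odd (k + j)) :
    p.coeff j = 0 := by
  have hX : (-X : R[X]) = C (-1) * X := by simp
  have hC : ((-1 : R[X]) ^ k) = C ((-1) ^ k) := by simp
  have h : p.coeff j * (-1) ^ j = (-1) ^ k * p.coeff j := by
    simpa only [hX, hC, comp_C_mul_X_coeff, coeff_C_mul] using congrArg (coeff · j) hp
  have hsign : (-1 : R) ^ k * (-1) ^ j = -1 := by rw [← pow_add, hj.neg_one_pow]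
  have hsq : (-1 : R) ^ k * (-1) ^ k = 1 := by rw [← pow_add, (Even.add_self k).neg_one_pow]
  refine self_eq_neg.1 ?_
  linear_combination (-p.coeff j) * hsq - (-1) ^ k * h + p.coeff j * hsign

end HasParity

/-- The monic three-term recurrence of a symmetric sequence of orthogonal polynomials. The
coefficient `c k` is the one usually indexed by `k + 2`, the degree that it produces. -/
structure IsThreeTerm {R : Type*} [CommRing R] (c : ℕ → R) (D : ℕ → R[X]) : Prop where
  zero : D 0 = 1
  one : D 1 = X
  add_two : ∀ k, D (k + 2) = X * D (k + 1) - C (c k) * D k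

namespace IsThreeTerm

variable {R : Type*} [CommRing R] {c : ℕ → R} {D : ℕ → R[X]}

lemma isMonicOfDegree [Nontrivial R] (h : IsThreeTerm c D) (k : ℕ) :
    IsMonicOfDegree (D k) k := by
  induction k using Nat.twoStepInduction with
  | zero => exact isMonicOfDegree_zero_iff.2 h.zero
  | one => exact h.one ▸ isMonicOfDegree_X R
  | more k ih ih' =>
    rw [h.add_two, show k + 2 = 1 + (k + 1) by lia]
    refine ((isMonicOfDegree_X R).mul ih').sub ((natDegree_C_mul_le _ _).trans_lt ?_)
    rw [ih.natDegree_eq]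
    lia

lemma degree_eq [Nontrivial R] (h : IsThreeTerm c D) (k : ℕ) : (D k).degree = k := by
  rw [degree_eq_natDegree (h.isMonicOfDegree k).ne_zero, (h.isMonicOfDegree k).natDegree_eq]

lemma hasParity (h : IsThreeTerm c D) (k : ℕ) : HasParity k (D k) := by
  induction k using Nat.twoStepInduction with
  | zero => simp [HasParity, h.zero]
  | one => simp [HasParity, h.one]
  | more k ih ih' => exact h.add_two k ▸ ih'.X_mul.sub (ih.add_two.C_mul _)

lemma eval_add_two (h : IsThreeTerm c D) (k : ℕ) (x : R) :
    (D (k + 2)).eval x = x * (D (k + 1)).eval x - c k * (D k).eval x := by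
  simp [h.add_two]

lemma eval_ne_zero_of_eval_succ_eq_zero [IsDomain R] (h : IsThreeTerm c D) (hc : ∀ k, c k ≠ 0)
    {x : R} {k : ℕ} (hk : (D (k + 1)).eval x = 0) : (D k).eval x ≠ 0 := by
  induction k with
  | zero => simp [h.zero]
  | succ k ih =>
    refine fun h0 => ih h0 ?_
    simpa [hk, h0, hc k] using h.eval_add_two k x

end IsThreeTerm

/-- The condition `Im (p / q) > 0` on the open upper half-plane, written without division. -/
def HermiteBiehler (p q : ℝ[X]) : Prop :=
  ∀ z : ℂ, 0 < z.im → 0 < (aeval z p * conj (aeval z q)).im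

namespace HermiteBiehler

variable {p q : ℝ[X]}

lemma X_one : HermiteBiehler X 1 := fun z hz => by simpa using hz

lemma aeval_ne_zero (h : HermiteBiehler p q) {z : ℂ} (hz : 0 < z.im) : aeval z p ≠ 0 := by
  intro h0
  simpa [h0] using h z hz

lemma im_eq_zero (h : HermiteBiehler p q) {z : ℂ} (hz : aeval z p = 0) : z.im = 0 := by
  rcases lt_trichotomy z.im 0 with hlt | heq | hgt
  · refine absurd ?_ (h.aeval_ne_zero (z := conj z) (by simpa using hlt))
    rw [aeval_conj, hz, map_zero]
  · exact heq
  · exact absurd hz (h.aeval_ne_zero hgt)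

lemma X_mul_sub_C_mul (h : HermiteBiehler p q) {e : ℝ} (he : 0 ≤ e) :
    HermiteBiehler (X * p - C e * q) p := by
  intro z hz
  have hexp : (aeval z (X * p - C e * q) * conj (aeval z p)).im
      = z.im * Complex.normSq (aeval z p) + e * (aeval z p * conj (aeval z q)).im := by
    simp [Complex.normSq_apply]
    ring
  have hpos : 0 < Complex.normSq (aeval z p) := Complex.normSq_pos.2 (h.aeval_ne_zero hz)
  have hq := h z hz
  rw [hexp]
  positivity

end HermiteBiehler

/-- All complex zeros of `A` are real, and `A'` and `B` have the same sign at each of them. The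
zeros of `A` are then simple, and exactly one zero of `B` separates any two consecutive ones when
the degree of `B` is one less. -/
structure StrictlyInterlaces (B A : ℝ[X]) : Prop where
  im_eq_zero : ∀ z : ℂ, aeval z A = 0 → z.im = 0
  derivative_mul_pos : ∀ x : ℝ, A.eval x = 0 → 0 < A.derivative.eval x * B.eval x

namespace IsThreeTerm

variable {c : ℕ → ℝ} {D : ℕ → ℝ[X]}

lemma hermiteBiehler (h : IsThreeTerm c D) (hc : ∀ k, 0 ≤ c k) (k : ℕ) :
    HermiteBiehler (D (k + 1)) (D k) := by
  induction k with
  | zero => exact h.one ▸ h.zero ▸ .X_one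
  | succ k ih => exact h.add_two k ▸ ih.X_mul_sub_C_mul (hc k)

lemma im_eq_zero (h : IsThreeTerm c D) (hc : ∀ k, 0 ≤ c k) {k : ℕ} {z : ℂ}
    (hz : aeval z (D k) = 0) : z.im = 0 := by
  cases k with
  | zero => simp [h.zero] at hz
  | succ k => exact (h.hermiteBiehler hc k).im_eq_zero hz

lemma wronskian_pos (h : IsThreeTerm c D) (hc : ∀ k, 0 < c k) (x : ℝ) (k : ℕ) :
    0 < (D (k + 1)).derivative.eval x * (D k).eval x
      - (D (k + 1)).eval x * (D k).derivative.eval x := by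
  induction k with
  | zero => simp [h.zero, h.one]
  | succ k ih =>
    have hder : (D (k + 2)).derivative.eval x = (D (k + 1)).eval x
        + x * (D (k + 1)).derivative.eval x - c k * (D k).derivative.eval x := by
      simp [h.add_two]
    rw [hder, h.eval_add_two]
    linarith [mul_pos (hc k) ih, sq_nonneg ((D (k + 1)).eval x)]

lemma strictlyInterlaces (h : IsThreeTerm c D) (hc : ∀ k, 0 < c k) (k : ℕ) :
    StrictlyInterlaces (D k) (D (k + 1)) where
  im_eq_zero _ hz := h.im_eq_zero (fun j => (hc j).le) hz
  derivative_mul_pos x hx := by simpa [hx] using h.wronskian_pos hc x k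

-- The Christoffel–Darboux difference `D_{k+1}(x) D_k(a) - D_{k+1}(a) D_k(x)` satisfies a
-- recurrence with nonnegative terms.
lemma eval_pos_of_le (h : IsThreeTerm c D) (hc : ∀ k, 0 ≤ c k) {a x : ℝ}
    (ha : ∀ k, 0 < (D k).eval a) (hx : a ≤ x) (k : ℕ) : 0 < (D k).eval x := by
  suffices hdiff : 0 < (D k).eval x ∧
      0 ≤ (D (k + 1)).eval x * (D k).eval a - (D (k + 1)).eval a * (D k).eval x from hdiff.1
  induction k with
  | zero => simpa [h.zero, h.one] using hx
  | succ k ih =>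
    obtain ⟨hk, hdiff⟩ := ih
    have hpos : 0 < (D (k + 1)).eval x := by
      refine (mul_pos_iff_of_pos_right (ha k)).1 ?_
      linarith [mul_pos (ha (k + 1)) hk]
    refine ⟨hpos, ?_⟩
    have hstep : (D (k + 2)).eval x * (D (k + 1)).eval a - (D (k + 2)).eval a * (D (k + 1)).eval x
        = (x - a) * ((D (k + 1)).eval x * (D (k + 1)).eval a) + c k *
          ((D (k + 1)).eval x * (D k).eval a - (D (k + 1)).eval a * (D k).eval x) := by
      rw [h.eval_add_two, h.eval_add_two]
      ring
    rw [hstep]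
    exact add_nonneg (mul_nonneg (sub_nonneg.2 hx) (mul_pos hpos (ha _)).le)
      (mul_nonneg (hc k) hdiff)

lemma mem_Ioo_of_eval_eq_zero (h : IsThreeTerm c D) (hc : ∀ k, 0 ≤ c k) {a x : ℝ}
    (ha : ∀ k, 0 < (D k).eval a) {k : ℕ} (hx : (D k).eval x = 0) : x ∈ Set.Ioo (-a) a := by
  constructor <;> by_contra! hle
  · have hpos := h.eval_pos_of_le hc ha (x := -x) (by linarith) k
    rw [(h.hasParity k).eval_neg, hx, mul_zero] at hpos
    exact hpos.false
  · exact (h.eval_pos_of_le hc ha hle k).ne' hx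

lemma exists_mem_Ioo_of_aeval_eq_zero (h : IsThreeTerm c D) (hc : ∀ k, 0 ≤ c k) {a : ℝ}
    (ha : ∀ k, 0 < (D k).eval a) {k : ℕ} {z : ℂ} (hz : aeval z (D k) = 0) :
    ∃ x : ℝ, x ∈ Set.Ioo (-a) a ∧ z = (x : ℂ) := by
  lift z to ℝ using h.im_eq_zero hc hz
  have hz' : (D k).eval z = 0 :=
    Complex.ofReal_eq_zero.1 ((aeval_ofReal (K := ℂ) (D k) z).symm.trans hz)
  exact ⟨z, h.mem_Ioo_of_eval_eq_zero hc ha hz', rfl⟩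

end IsThreeTerm

/-- `p` is orthogonal to the polynomials of degree less than `k` for the moment functional `L`,
the analogue of `q ↦ ∫ q dμ`. -/
def OrthogonalBelow {R : Type*} [CommRing R] (L : R[X] →ₗ[R] R) (k : ℕ) (p : R[X]) : Prop :=
  ∀ q : R[X], q.degree < k → L (p * q) = 0

namespace OrthogonalBelow

variable {R : Type*} [CommRing R] {L : R[X] →ₗ[R] R} {k : ℕ} {p q : R[X]}

lemma mono {j : ℕ} (h : OrthogonalBelow L k p) (hj : j ≤ k) : OrthogonalBelow L j p :=
  fun q hq => h q (hq.trans_le (by exact_mod_cast hj))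

lemma C_mul (h : OrthogonalBelow L k p) (c : R) : OrthogonalBelow L k (C c * p) := fun q hq => by
  rw [mul_assoc, ← smul_eq_C_mul, map_smul, h q hq, smul_zero]

lemma sub (hp : OrthogonalBelow L k p) (hq : OrthogonalBelow L k q) :
    OrthogonalBelow L k (p - q) := fun r hr => by
  rw [sub_mul, map_sub, hp r hr, hq r hr, sub_zero]

lemma X_mul (h : OrthogonalBelow L (k + 1) p) : OrthogonalBelow L k (X * p) := fun q hq => by
  rw [mul_comm X, mul_assoc]
  refine h _ ?_
  rw [mul_comm, degree_lt_iff_coeff_zero]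
  rintro (_ | m) hm
  · lia
  · rw [coeff_mul_X]
    exact (degree_lt_iff_coeff_zero _ _).1 hq m (by lia)

lemma apply_mul_eq (h : OrthogonalBelow L k p) (hp : IsMonicOfDegree p k)
    (hq : q.natDegree ≤ k) : L (p * q) = q.coeff k * L (p * p) := by
  have hone : p.coeff k = 1 := hp.natDegree_eq ▸ hp.monic.coeff_natDegree
  have hdeg : (q - C (q.coeff k) * p).degree < k := by
    rw [degree_lt_iff_coeff_zero]
    intro m hm
    rcases hm.eq_or_lt with rfl | hm
    · simp [hone]
    · simp [coeff_eq_zero_of_natDegree_lt (hq.trans_lt hm),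
        coeff_eq_zero_of_natDegree_lt (hp.natDegree_eq.trans_lt hm)]
  have h0 := h _ hdeg
  rw [mul_sub, mul_left_comm, ← smul_eq_C_mul, map_sub, map_smul, smul_eq_mul] at h0
  exact sub_eq_zero.1 h0

end OrthogonalBelow

/-- The quadratic form `q ↦ L (q ^ 2)` is positive definite on the polynomials of degree less
than `N`. -/
def PosDefBelow {R : Type*} [CommRing R] [LT R] (L : R[X] →ₗ[R] R) (N : ℕ) : Prop :=
  ∀ q : R[X], q ≠ 0 → q.degree < N → 0 < L (q * q)

/-- `p` is the `k`-th monic orthogonal polynomial of the moment functional `L`, and it has the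
parity of `k`, as it does when the odd moments of `L` vanish. -/
structure IsSymmOrthogonal {R : Type*} [CommRing R] (L : R[X] →ₗ[R] R) (k : ℕ) (p : R[X]) :
    Prop where
  isMonicOfDegree : IsMonicOfDegree p k
  hasParity : HasParity k p
  orthogonalBelow : OrthogonalBelow L k p

namespace IsSymmOrthogonal

section CommRing

variable {R : Type*} [CommRing R] {L : R[X] →ₗ[R] R} {k : ℕ} {A B : R[X]}

lemma orthogonalBelow_X_mul_sub (hA : IsSymmOrthogonal L (k + 2) A)
    (hB : IsSymmOrthogonal L (k + 1) B) : OrthogonalBelow L k (X * B - A) :=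
  hB.orthogonalBelow.X_mul.sub (hA.orthogonalBelow.mono (by lia))

lemma hasParity_X_mul_sub (hA : IsSymmOrthogonal L (k + 2) A)
    (hB : IsSymmOrthogonal L (k + 1) B) : HasParity k (X * B - A) := by
  rw [HasParity, hB.hasParity.X_mul.sub hA.hasParity, pow_add (-1) k 2, neg_one_sq, mul_one]

lemma natDegree_X_mul_sub_le [Nontrivial R] [IsAddTorsionFree R]
    (hA : IsSymmOrthogonal L (k + 2) A) (hB : IsSymmOrthogonal L (k + 1) B) :
    (X * B - A).natDegree ≤ k := by
  have hXB : IsMonicOfDegree (X * B) (k + 2) := by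
    convert (isMonicOfDegree_X R).mul hB.isMonicOfDegree using 1
    lia
  have hlt := hXB.natDegree_sub_lt (by lia) hA.isMonicOfDegree
  rw [natDegree_le_iff_coeff_eq_zero]
  intro N hN
  rcases Nat.lt_or_ge (k + 1) N with h | h
  · exact coeff_eq_zero_of_natDegree_lt (by lia)
  · obtain rfl : N = k + 1 := by lia
    exact (hA.hasParity_X_mul_sub hB).coeff_eq_zero ⟨k, by ring⟩

lemma apply_X_mul_sub_mul (hA : IsSymmOrthogonal L (k + 2) A)
    (hB : IsSymmOrthogonal L (k + 1) B) {r : R[X]} (hr : r.natDegree ≤ k) :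
    L ((X * B - A) * r) = r.coeff k * L (B * B) := by
  have hXr : (X * r).natDegree ≤ k + 1 := by
    refine natDegree_mul_le.trans ?_
    have := natDegree_X_le (R := R)
    lia
  have hAr : L (A * r) = 0 := hA.orthogonalBelow r (degree_le_natDegree.trans_lt (by
    exact_mod_cast (by lia : r.natDegree < k + 2)))
  rw [sub_mul, map_sub, hAr, sub_zero, mul_comm X, mul_assoc,
    hB.orthogonalBelow.apply_mul_eq hB.isMonicOfDegree hXr, coeff_X_mul]

end CommRing

variable {K : Type*} [Field K] [LinearOrder K] [IsStrictOrderedRing K] {L : K[X] →ₗ[K] K}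
  {k N : ℕ} {A B : K[X]}

-- `L ((X * B - A) ^ 2)` is the product of this coefficient and `L (B ^ 2)`.
lemma coeff_X_mul_sub_pos (hA : IsSymmOrthogonal L (k + 2) A)
    (hB : IsSymmOrthogonal L (k + 1) B) (hL : PosDefBelow L N) (hk : k + 1 < N) :
    0 < (X * B - A).coeff k := by
  have hdeg := hA.natDegree_X_mul_sub_le hB
  have hBB : 0 < L (B * B) := hL B hB.isMonicOfDegree.ne_zero <| by
    rw [degree_eq_natDegree hB.isMonicOfDegree.ne_zero, hB.isMonicOfDegree.natDegree_eq]
    exact_mod_cast hk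
  have hne : X * B - A ≠ 0 := by
    intro h0
    have h := hA.apply_X_mul_sub_mul hB (r := X ^ k) (natDegree_X_pow_le k)
    rw [h0, zero_mul, map_zero, coeff_X_pow_self, one_mul] at h
    exact hBB.ne h
  have hsq := hL _ hne (degree_le_natDegree.trans_lt (by exact_mod_cast (by lia)))
  rw [hA.apply_X_mul_sub_mul hB hdeg] at hsq
  exact (mul_pos_iff_of_pos_right hBB).1 hsq

lemma backward (hA : IsSymmOrthogonal L (k + 2) A) (hB : IsSymmOrthogonal L (k + 1) B)
    (hc : (X * B - A).coeff k ≠ 0) :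
    IsSymmOrthogonal L k (C ((X * B - A).coeff k)⁻¹ * (X * B - A)) where
  isMonicOfDegree := by
    refine (isMonicOfDegree_iff _ _).2 ⟨(natDegree_C_mul_le _ _).trans
      (hA.natDegree_X_mul_sub_le hB), ?_⟩
    rw [coeff_C_mul, inv_mul_cancel₀ hc]
  hasParity := (hA.hasParity_X_mul_sub hB).C_mul _
  orthogonalBelow := (hA.orthogonalBelow_X_mul_sub hB).C_mul _

end IsSymmOrthogonal

namespace IsThreeTerm

variable {K : Type*} [Field K] {L : K[X] →ₗ[K] K} {c : ℕ → K} {D : ℕ → K[X]} {N : ℕ}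

lemma orthogonalBelow (h : IsThreeTerm c D) (hc : ∀ k, c k ≠ 0)
    (hsucc : OrthogonalBelow L (N + 1) (D (N + 1))) (hself : OrthogonalBelow L N (D N)) {j : ℕ}
    (hj : j ≤ N + 1) : OrthogonalBelow L j (D j) := by
  suffices hboth : ∀ j ≤ N, OrthogonalBelow L j (D j) ∧ OrthogonalBelow L (j + 1) (D (j + 1)) by
    rcases hj.lt_or_eq with hlt | rfl
    · exact (hboth j (by lia)).1
    · exact hsucc
  intro j hj
  induction hj using Nat.decreasingInduction with
  | self => exact ⟨hself, hsucc⟩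
  | of_succ k _ ih =>
    refine ⟨?_, ih.1⟩
    have hback : D k = C (c k)⁻¹ * (X * D (k + 1) - D (k + 2)) := by
      rw [h.add_two, sub_sub_cancel, ← mul_assoc, ← C_mul, inv_mul_cancel₀ (hc k), C_1, one_mul]
    rw [hback]
    exact (ih.1.X_mul.sub (ih.2.mono (by lia))).C_mul _

lemma apply_mul_self (h : IsThreeTerm c D)
    (horth : ∀ j ≤ N + 1, OrthogonalBelow L j (D j)) {i : ℕ} (hi : i ≤ N) :
    L (D i * D i) = (∏ k ∈ Finset.range i, c k) * L 1 := by
  induction i with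
  | zero => simp [h.zero]
  | succ i ih =>
    have hXD : IsMonicOfDegree (X * D i) (i + 1) := by
      rw [add_comm]
      exact (isMonicOfDegree_X K).mul (h.isMonicOfDegree i)
    have hX : L (D (i + 1) * (X * D i)) = L (D (i + 1) * D (i + 1)) := by
      rw [(horth (i + 1) (by lia)).apply_mul_eq (h.isMonicOfDegree _) hXD.natDegree_eq.le,
        ((isMonicOfDegree_iff _ _).1 hXD).2, one_mul]
    have hzero : L (D (i + 2) * D i) = 0 := horth (i + 2) (by lia) _ <| by
      rw [h.degree_eq]
      exact_mod_cast (by lia : i < i + 2)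
    have hsplit : D (i + 1) * (X * D i) = D (i + 2) * D i + c i • (D i * D i) := by
      rw [h.add_two, smul_eq_C_mul]
      ring
    rw [← hX, hsplit, map_add, hzero, zero_add, map_smul, ih (by lia), smul_eq_mul,
      Finset.prod_range_succ]
    ring

lemma apply_mul (h : IsThreeTerm c D) (horth : ∀ j ≤ N + 1, OrthogonalBelow L j (D j)) {i j : ℕ}
    (hi : i ≤ N) (hj : j ≤ N) :
    L (D i * D j) = if i = j then (∏ k ∈ Finset.range i, c k) * L 1 else 0 := by
  rcases lt_trichotomy i j with hlt | rfl | hgt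
  · rw [if_neg hlt.ne, mul_comm]
    exact horth j (by lia) _ (by rw [h.degree_eq]; exact_mod_cast hlt)
  · rw [if_pos rfl, h.apply_mul_self horth hi]
  · rw [if_neg hgt.ne']
    exact horth i (by lia) _ (by rw [h.degree_eq]; exact_mod_cast hgt)

end IsThreeTerm

/-- The moment functional of the discrete measure with weights `w` on `s`. -/
noncomputable def discreteFunctional {R : Type*} [CommRing R] (s : Finset R) (w : R → R) :
    R[X] →ₗ[R] R :=
  ∑ x ∈ s, w x • leval x

section DiscreteFunctional

lemma discreteFunctional_apply {R : Type*} [CommRing R] (s : Finset R) (w : R → R) (p : R[X]) :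
    discreteFunctional s w p = ∑ x ∈ s, w x * p.eval x := by
  simp [discreteFunctional]

variable {K : Type*} [Field K] [LinearOrder K] [IsStrictOrderedRing K] {s : Finset K} {w : K → K}

lemma posDefBelow_discreteFunctional (hw : ∀ x ∈ s, 0 < w x) :
    PosDefBelow (discreteFunctional s w) s.card := by
  intro q hq hdeg
  obtain ⟨x, hx, hqx⟩ : ∃ x ∈ s, q.eval x ≠ 0 := by
    by_contra! h
    exact hq (eq_zero_of_degree_lt_of_eval_finset_eq_zero s hdeg h)
  simp only [discreteFunctional_apply, eval_mul]
  exact Finset.sum_pos' (fun y hy => mul_nonneg (hw y hy).le (mul_self_nonneg _))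
    ⟨x, hx, mul_pos (hw x hx) (mul_self_pos.2 hqx)⟩

-- A zero `y` would leave a quotient `q` by `X - y` with `L (p * q) = 0`, while `(y - X) * q ^ 2`
-- is nonnegative on the support.
lemma OrthogonalBelow.eval_ne_zero_of_forall_lt {k : ℕ} {p : K[X]}
    (h : OrthogonalBelow (discreteFunctional s w) k p) (hw : ∀ x ∈ s, 0 < w x)
    (hp : IsMonicOfDegree p k) (hk : k ≤ s.card) {y : K} (hy : ∀ x ∈ s, x < y) :
    p.eval y ≠ 0 := by
  intro h0
  obtain ⟨q, hq⟩ := dvd_iff_isRoot.2 h0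
  have hq0 : q ≠ 0 := by
    rintro rfl
    exact hp.ne_zero (by simpa using hq)
  have hdeg : q.degree < k := by
    rw [← hp.natDegree_eq, ← degree_eq_natDegree hp.ne_zero, hq, degree_mul, degree_X_sub_C,
      degree_eq_natDegree hq0]
    exact_mod_cast (by lia : q.natDegree < 1 + q.natDegree)
  have hpos : 0 < discreteFunctional s (fun x => w x * (y - x)) (q * q) :=
    posDefBelow_discreteFunctional (fun x hx => mul_pos (hw x hx) (sub_pos.2 (hy x hx))) q hq0
      (hdeg.trans_le (by exact_mod_cast hk))
  have hneg : discreteFunctional s (fun x => w x * (y - x)) (q * q)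
      = -discreteFunctional s w (p * q) := by
    simp only [discreteFunctional_apply, ← Finset.sum_neg_distrib]
    refine Finset.sum_congr rfl fun x _ => ?_
    simp only [hq, eval_mul, eval_sub, eval_X, eval_C]
    ring
  rw [hneg, h q hdeg, neg_zero] at hpos
  exact hpos.false

end DiscreteFunctional

lemma exists_gt_isRoot_of_eval_neg {p : ℝ[X]} (hp : p.Monic) {b : ℝ} (hb : p.eval b < 0) :
    ∃ x, b < x ∧ p.IsRoot x := by
  have hdeg : 0 < p.degree := by
    rw [← natDegree_pos_iff_degree_pos, Nat.pos_iff_ne_zero]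
    intro h0
    norm_num [hp.natDegree_eq_zero.1 h0] at hb
  have htend := p.tendsto_atTop_of_leadingCoeff_nonneg hdeg (by simp [hp.leadingCoeff])
  obtain ⟨c, hc, hbc⟩ := ((htend.eventually_gt_atTop 0).and (Filter.eventually_ge_atTop b)).exists
  obtain ⟨x, hx, hx0⟩ := intermediate_value_Ioo hbc p.continuous.continuousOn ⟨hb, hc⟩
  exact ⟨x, hx.1, hx0⟩

lemma OrthogonalBelow.eval_pos_of_forall_lt {s : Finset ℝ} {w : ℝ → ℝ} {k : ℕ} {p : ℝ[X]}
    (h : OrthogonalBelow (discreteFunctional s w) k p) (hw : ∀ x ∈ s, 0 < w x)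
    (hp : IsMonicOfDegree p k) (hk : k ≤ s.card) {a : ℝ} (ha : ∀ x ∈ s, x < a) :
    0 < p.eval a := by
  have hne : ∀ y, a ≤ y → p.eval y ≠ 0 := fun y hy =>
    h.eval_ne_zero_of_forall_lt hw hp hk fun x hx => (ha x hx).trans_le hy
  by_contra! hle
  obtain ⟨y, hy, hy0⟩ := exists_gt_isRoot_of_eval_neg hp.monic (hle.lt_of_ne (hne a le_rfl))
  exact hne y hy.le hy0

lemma splits_of_forall_im_eq_zero {p : ℝ[X]} (h : ∀ z : ℂ, aeval z p = 0 → z.im = 0) :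
    p.Splits := by
  refine Splits.of_splits_map (algebraMap ℝ ℂ) (IsAlgClosed.splits _) fun z hz => ?_
  have hz0 : aeval z p = 0 := by
    rw [← eval_map_algebraMap]
    exact isRoot_of_mem_roots hz
  exact ⟨z.re, Complex.ext (by simp) (by simp [h z hz0])⟩

lemma sum_eval_div_eval_derivative_nodal {K : Type*} [Field K] {s : Finset K}
    {q : K[X]} (hq : q.degree < s.card) :
    ∑ x ∈ s, q.eval x / (Lagrange.nodal s id).derivative.eval x = q.coeff (s.card - 1) := by
  classical
  rw [Lagrange.coeff_eq_sum (v := id) (Set.injOn_id _) hq]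
  refine Finset.sum_congr rfl fun x hx => ?_
  have h := Lagrange.eval_nodal_derivative_eval_node_eq (v := (id : K → K)) hx
  rw [Lagrange.eval_nodal] at h
  simp only [id] at h ⊢
  rw [h]

namespace StrictlyInterlaces

variable {A B : ℝ[X]}

lemma nodup_roots (h : StrictlyInterlaces B A) (hA : A ≠ 0) : A.roots.Nodup := by
  rw [Multiset.nodup_iff_count_le_one]
  intro x
  rw [count_roots]
  by_contra! hlt
  obtain ⟨h0, hder⟩ := (one_lt_rootMultiplicity_iff_isRoot hA).1 hlt
  simpa [hder.eq_zero] using h.derivative_mul_pos x h0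

lemma card_toFinset_roots (h : StrictlyInterlaces B A) (hA : A ≠ 0) :
    A.roots.toFinset.card = A.natDegree := by
  rw [Multiset.toFinset_card_of_nodup (h.nodup_roots hA),
    (splits_of_forall_im_eq_zero h.im_eq_zero).natDegree_eq_card_roots]

lemma nodal_toFinset_roots (h : StrictlyInterlaces B A) (hA : A.Monic) :
    Lagrange.nodal A.roots.toFinset id = A := by
  rw [Lagrange.nodal_eq, Finset.prod, Multiset.toFinset_val, (h.nodup_roots hA.ne_zero).dedup]
  exact ((splits_of_forall_im_eq_zero h.im_eq_zero).eq_prod_roots_of_monic hA).symm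

end StrictlyInterlaces

/-- The weight at the zero `x` of `A` in the Gauss quadrature whose orthogonal polynomials of the
two highest degrees are `A` and `B`. -/
noncomputable def gaussWeight (A B : ℝ[X]) (x : ℝ) : ℝ := (A.derivative.eval x * B.eval x)⁻¹

/-- The Gauss quadrature at the zeros of `A` whose orthogonal polynomials of the two highest
degrees are `A` and `B`; it is not normalized. -/
noncomputable def gaussFunctional (A B : ℝ[X]) : ℝ[X] →ₗ[ℝ] ℝ :=
  discreteFunctional A.roots.toFinset (gaussWeight A B)

namespace StrictlyInterlaces

variable {A B : ℝ[X]} {N : ℕ}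

lemma gaussWeight_pos (h : StrictlyInterlaces B A) {x : ℝ} (hx : x ∈ A.roots.toFinset) :
    0 < gaussWeight A B x :=
  inv_pos.2 (h.derivative_mul_pos x (isRoot_of_mem_roots (Multiset.mem_toFinset.1 hx)))

lemma posDefBelow_gaussFunctional (h : StrictlyInterlaces B A) (hA : A ≠ 0) :
    PosDefBelow (gaussFunctional A B) A.natDegree := by
  rw [← h.card_toFinset_roots hA]
  exact posDefBelow_discreteFunctional fun x hx => h.gaussWeight_pos hx

lemma orthogonalBelow_gaussFunctional (h : StrictlyInterlaces B A)
    (hA : IsMonicOfDegree A (N + 1)) : OrthogonalBelow (gaussFunctional A B) N B := by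
  intro q hq
  have hcard : A.roots.toFinset.card = N + 1 :=
    (h.card_toFinset_roots hA.ne_zero).trans hA.natDegree_eq
  have hcoeff : q.coeff (A.roots.toFinset.card - 1) = 0 :=
    coeff_eq_zero_of_degree_lt (by simpa [hcard] using hq)
  rw [← hcoeff, ← sum_eval_div_eval_derivative_nodal (hq.trans (by
    rw [hcard]; exact_mod_cast N.lt_succ_self)), h.nodal_toFinset_roots hA.monic, gaussFunctional,
    discreteFunctional_apply]
  refine Finset.sum_congr rfl fun x hx => ?_
  have hB : B.eval x ≠ 0 := right_ne_zero_of_mul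
    (h.derivative_mul_pos x (isRoot_of_mem_roots (Multiset.mem_toFinset.1 hx))).ne'
  rw [gaussWeight, eval_mul]
  field_simp

end StrictlyInterlaces

lemma orthogonalBelow_gaussFunctional_self (A B : ℝ[X]) (k : ℕ) :
    OrthogonalBelow (gaussFunctional A B) k A := by
  intro q _
  rw [gaussFunctional, discreteFunctional_apply]
  refine Finset.sum_eq_zero fun x hx => ?_
  rw [eval_mul, (isRoot_of_mem_roots (Multiset.mem_toFinset.1 hx)).eq_zero, zero_mul, mul_zero]

lemma exists_probabilityMeasure_integral_eval {s : Finset ℝ} {w : ℝ → ℝ} {S : Set ℝ}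
    (hw : ∀ x ∈ s, 0 < w x) (hs : s.Nonempty) (hS : ∀ x ∈ s, x ∈ S) :
    ∃ μ : ProbabilityMeasure S, ∀ p : ℝ[X], ∫ x : S, p.eval (x : ℝ) ∂(μ : Measure S)
      = discreteFunctional s w p / discreteFunctional s w 1 := by
  have hmass : 0 < discreteFunctional s w 1 := by
    simpa [discreteFunctional_apply] using Finset.sum_pos hw hs
  have hmass_eq : ∑ x ∈ s.attach, w x / discreteFunctional s w 1 = 1 := by
    rw [← Finset.sum_div, Finset.sum_attach s w, div_eq_one_iff_eq hmass.ne']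
    simp [discreteFunctional_apply]
  have hnonneg : ∀ x ∈ s.attach, 0 ≤ w x / discreteFunctional s w 1 := fun x _ =>
    (div_pos (hw x x.2) hmass).le
  let μ : Measure S := ∑ x ∈ s.attach,
    ENNReal.ofReal (w x / discreteFunctional s w 1) • Measure.dirac ⟨x, hS x x.2⟩
  have hμ : IsProbabilityMeasure μ := by
    constructor
    simp only [μ, Measure.finsetSum_apply, Measure.smul_apply, measure_univ, smul_eq_mul, mul_one]
    rw [← ENNReal.ofReal_sum_of_nonneg hnonneg, hmass_eq, ENNReal.ofReal_one]
  refine ⟨⟨μ, hμ⟩, fun p => ?_⟩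
  change ∫ x : S, p.eval (x : ℝ) ∂μ = _
  rw [integral_finsetSum_measure fun i _ =>
    (integrable_dirac (by simp)).smul_measure ENNReal.ofReal_ne_top, discreteFunctional_apply s w p,
    Finset.sum_div, ← Finset.sum_attach s]
  refine Finset.sum_congr rfl fun x hx => ?_
  rw [integral_smul_measure, integral_dirac, ENNReal.toReal_ofReal (hnonneg x hx), smul_eq_mul]
  ring

open Filter Topology in
lemma exists_probabilityMeasure_of_tendsto_integral {Y ι α : Type*} [TopologicalSpace Y]
    [CompactSpace Y] [T2Space Y] [SecondCountableTopology Y] [MeasurableSpace Y] [BorelSpace Y]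
    {l : Filter α} [l.NeBot] {μ : α → ProbabilityMeasure Y} {f : ι → C(Y, ℝ)} {m : ι → ℝ}
    (h : ∀ i, Tendsto (fun n => ∫ y, f i y ∂(μ n : Measure Y)) l (𝓝 (m i))) :
    ∃ ν : ProbabilityMeasure Y, ∀ i, ∫ y, f i y ∂(ν : Measure Y) = m i := by
  obtain ⟨ν, -, hν⟩ := isCompact_univ.ultrafilter_le_nhds ((Ultrafilter.of l).map μ) (by simp)
  have hlim : Tendsto μ (Ultrafilter.of l) (𝓝 ν) := hν
  refine ⟨ν, fun i => tendsto_nhds_unique ?_ ((h i).mono_left (Ultrafilter.of_le l))⟩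
  exact ProbabilityMeasure.tendsto_iff_forall_integral_tendsto.1 hlim
    (BoundedContinuousFunction.mkOfCompact (f i))

namespace IsThreeTerm

variable {c : ℕ → ℝ} {D : ℕ → ℝ[X]} {a : ℝ}

lemma exists_probabilityMeasure_of_le (h : IsThreeTerm c D) (hc : ∀ k, 0 < c k)
    (ha : ∀ k, 0 < (D k).eval a) (N : ℕ) : ∃ μ : ProbabilityMeasure (Set.Icc (-a) a),
      ∀ i ≤ N, ∀ j ≤ N, ∫ x : Set.Icc (-a) a, (D i * D j).eval (x : ℝ) ∂(μ : Measure _)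
        = if i = j then ∏ k ∈ Finset.range i, c k else 0 := by
  have hint : StrictlyInterlaces (D N) (D (N + 1)) := h.strictlyInterlaces hc N
  have hmonic : IsMonicOfDegree (D (N + 1)) (N + 1) := h.isMonicOfDegree _
  have hcard : (D (N + 1)).roots.toFinset.card = N + 1 :=
    (hint.card_toFinset_roots hmonic.ne_zero).trans hmonic.natDegree_eq
  have horth : ∀ j ≤ N + 1, OrthogonalBelow (gaussFunctional (D (N + 1)) (D N)) j (D j) :=
    fun _ => h.orthogonalBelow (fun k => (hc k).ne') (orthogonalBelow_gaussFunctional_self _ _ _)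
      (hint.orthogonalBelow_gaussFunctional hmonic)
  have hmass : 0 < gaussFunctional (D (N + 1)) (D N) 1 := by
    simpa using hint.posDefBelow_gaussFunctional hmonic.ne_zero 1 one_ne_zero
      (by rw [hmonic.natDegree_eq, degree_one]; exact_mod_cast N.succ_pos)
  obtain ⟨μ, hμ⟩ := exists_probabilityMeasure_integral_eval (S := Set.Icc (-a) a)
    (fun x hx => hint.gaussWeight_pos hx) (Finset.card_pos.1 (by lia))
    (fun x hx => Set.Ioo_subset_Icc_self (h.mem_Ioo_of_eval_eq_zero (fun k => (hc k).le) ha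
      (isRoot_of_mem_roots (Multiset.mem_toFinset.1 hx))))
  refine ⟨μ, fun i hi j hj => ?_⟩
  rw [hμ, ← gaussFunctional, h.apply_mul horth hi hj, ite_div, zero_div,
    mul_div_cancel_right₀ _ hmass.ne']

open Filter in
/-- Favard's theorem with a bound on the support. -/
theorem exists_isMonicOrthogonal (h : IsThreeTerm c D) (hc : ∀ k, 0 < c k)
    (ha : ∀ k, 0 < (D k).eval a) :
    ∃ μ : Measure ℝ, μ (Set.Icc (-a) a)ᶜ = 0 ∧ IsMonicOrthogonal D μ := by
  choose μ hμ using h.exists_probabilityMeasure_of_le hc ha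
  let f (ij : ℕ × ℕ) : C(Set.Icc (-a) a, ℝ) :=
    ⟨fun x => (D ij.1 * D ij.2).eval (x : ℝ), by fun_prop⟩
  obtain ⟨ν, hν⟩ := exists_probabilityMeasure_of_tendsto_integral (l := atTop) (μ := μ) (f := f)
    (m := fun ij => if ij.1 = ij.2 then ∏ k ∈ Finset.range ij.1, c k else 0) fun ij => by
      refine tendsto_const_nhds.congr' ?_
      filter_upwards [eventually_ge_atTop (max ij.1 ij.2)] with N hN
      exact (hμ N _ (le_of_max_le_left hN) _ (le_of_max_le_right hN)).symm
  have hemb : MeasurableEmbedding ((↑) : Set.Icc (-a) a → ℝ) :=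
    .subtype_coe measurableSet_Icc
  let κ : Measure ℝ := (ν : Measure (Set.Icc (-a) a)).map (↑)
  have hinner (i j : ℕ) : ∫ x, (D i).eval x * (D j).eval x ∂κ
      = if i = j then ∏ k ∈ Finset.range i, c k else 0 := by
    simpa only [κ, hemb.integral_map, f, eval_mul, ContinuousMap.coe_mk] using hν (i, j)
  refine ⟨κ, ?_, fun m => (h.isMonicOfDegree m).monic,
    fun m => (h.isMonicOfDegree m).natDegree_eq, fun i j => ?_, fun i j hij => ?_, fun i => ?_⟩
  · rw [hemb.map_apply, Set.preimage_compl, Subtype.coe_preimage_self, Set.compl_univ,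
      measure_empty]
  · rw [hemb.integrable_map_iff]
    exact Continuous.integrable_of_hasCompactSupport (by fun_prop)
      (HasCompactSupport.of_compactSpace _)
  · rw [hinner, if_neg hij]
  · rw [hinner, if_pos rfl]
    exact Finset.prod_pos fun k _ => hc k

end IsThreeTerm

section Ultraspherical

variable {lam : ℝ}

lemma isThreeTerm_ultraspherical (lam : ℝ) :
    IsThreeTerm (fun k => ultrasphericalCoeff lam (k + 2)) (ultraspherical lam) :=
  ⟨by rw [ultraspherical], by rw [ultraspherical], fun k => by rw [ultraspherical]⟩

lemma ultrasphericalCoeff_add_two (lam : ℝ) (k : ℕ) : ultrasphericalCoeff lam (k + 2)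
    = ((k + 1) * (k + 2 * lam)) / (4 * (k + lam) * (k + 1 + lam)) := by
  rw [ultrasphericalCoeff]
  push_cast
  congr 1 <;> ring

lemma ultrasphericalCoeff_two (hlam : lam ≠ 0) :
    ultrasphericalCoeff lam 2 = 1 / (2 * (1 + lam)) := by
  rw [ultrasphericalCoeff_add_two lam 0, Nat.cast_zero, zero_add, zero_add, zero_add, one_mul,
    show 4 * lam * (1 + lam) = 2 * lam * (2 * (1 + lam)) by ring,
    div_mul_cancel_left₀ (mul_ne_zero two_ne_zero hlam), one_div]

lemma ultrasphericalCoeff_pos (hlam : -1 / 2 < lam) (hlam0 : lam ≠ 0) (k : ℕ) :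
    0 < ultrasphericalCoeff lam (k + 2) := by
  rcases k.eq_zero_or_pos with rfl | hk
  · rw [ultrasphericalCoeff_two hlam0]
    exact one_div_pos.2 (by linarith)
  · have hk1 : (1 : ℝ) ≤ k := by exact_mod_cast hk
    have hnum : 0 < (k : ℝ) + 2 * lam := by linarith
    have hden : 0 < (k : ℝ) + lam := by linarith
    have hden' : 0 < (k : ℝ) + 1 + lam := by linarith
    rw [ultrasphericalCoeff_add_two]
    positivity

lemma add_natCast_ne_zero_of_two_mul (hlam : ∀ k : ℕ, k + 2 * lam ≠ 0) (k : ℕ) : k + lam ≠ 0 := by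
  intro h
  refine hlam (2 * k) ?_
  push_cast
  linear_combination 2 * h

lemma ultrasphericalCoeff_ne_zero (hlam : ∀ k : ℕ, k + 2 * lam ≠ 0) (k : ℕ) :
    ultrasphericalCoeff lam (k + 2) ≠ 0 := by
  have hden := add_natCast_ne_zero_of_two_mul hlam k
  have hden' := add_natCast_ne_zero_of_two_mul hlam (k + 1)
  rw [Nat.cast_add_one] at hden'
  rw [ultrasphericalCoeff_add_two]
  exact div_ne_zero (mul_ne_zero k.cast_add_one_ne_zero (hlam k))
    (mul_ne_zero (mul_ne_zero four_ne_zero hden) hden')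

/-- The coefficient `d_k` in the connection formula
`C_{k+2}^λ = x C_{k+1}^{λ+1} - d_k C_k^{λ+1}`. -/
noncomputable def connectionCoeff (lam : ℝ) (k : ℕ) : ℝ := (k + 1) / (2 * (k + 1 + lam))

lemma connectionCoeff_zero (hlam : lam ≠ 0) :
    connectionCoeff lam 0 = ultrasphericalCoeff lam 2 := by
  rw [ultrasphericalCoeff_two hlam, connectionCoeff, Nat.cast_zero, zero_add]

lemma connectionCoeff_add (k : ℕ) (h1 : k + 1 + lam ≠ 0) (h2 : k + 2 + lam ≠ 0) :
    connectionCoeff lam k + ultrasphericalCoeff lam (k + 3)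
      = ultrasphericalCoeff (lam + 1) (k + 2) + connectionCoeff lam (k + 1) := by
  rw [connectionCoeff, connectionCoeff, ultrasphericalCoeff_add_two lam (k + 1),
    ultrasphericalCoeff_add_two]
  push_cast
  rw [show (k : ℝ) + (lam + 1) = k + 1 + lam by ring,
    show (k : ℝ) + 1 + 1 + lam = k + 2 + lam by ring,
    show (k : ℝ) + 1 + (lam + 1) = k + 2 + lam by ring]
  field_simp
  ring

lemma connectionCoeff_mul (k : ℕ) (h1 : k + 1 + lam ≠ 0) (h2 : k + 2 + lam ≠ 0)
    (h3 : k + 3 + lam ≠ 0) :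
    ultrasphericalCoeff lam (k + 4) * connectionCoeff lam k
      = connectionCoeff lam (k + 2) * ultrasphericalCoeff (lam + 1) (k + 2) := by
  rw [connectionCoeff, connectionCoeff, ultrasphericalCoeff_add_two lam (k + 2),
    ultrasphericalCoeff_add_two]
  push_cast
  rw [show (k : ℝ) + (lam + 1) = k + 1 + lam by ring,
    show (k : ℝ) + 2 + 1 + lam = k + 3 + lam by ring,
    show (k : ℝ) + 1 + (lam + 1) = k + 2 + lam by ring]
  field_simp
  ring

lemma connectionCoeff_nonneg {k : ℕ} (hlam : 0 < k + 1 + lam) : 0 ≤ connectionCoeff lam k := by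
  rw [connectionCoeff]
  positivity

lemma ultraspherical_add_two_eq (hlam : ∀ k : ℕ, k + lam ≠ 0) (k : ℕ) : ultraspherical lam (k + 2)
    = X * ultraspherical (lam + 1) (k + 1)
      - C (connectionCoeff lam k) * ultraspherical (lam + 1) k := by
  have hC := isThreeTerm_ultraspherical lam
  have hP := isThreeTerm_ultraspherical (lam + 1)
  have h1 (j : ℕ) : j + 1 + lam ≠ 0 := by exact_mod_cast hlam (j + 1)
  have h2 (j : ℕ) : j + 2 + lam ≠ 0 := by exact_mod_cast hlam (j + 2)
  have h3 (j : ℕ) : j + 3 + lam ≠ 0 := by exact_mod_cast hlam (j + 3)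
  have hzero := connectionCoeff_zero (by simpa using hlam 0)
  induction k using Nat.twoStepInduction with
  | zero => rw [hC.add_two, hC.one, hC.zero, hP.one, hP.zero, hzero]
  | one =>
    have hadd := congrArg C (connectionCoeff_add 0 (h1 0) (h2 0))
    rw [hzero, C_add, C_add] at hadd
    rw [hC.add_two, hC.add_two, hC.one, hC.zero, hP.add_two, hP.one, hP.zero]
    linear_combination (-X) * hadd
  | more k ih ih' =>
    have hadd := congrArg C (connectionCoeff_add (k + 1) (h1 _) (h2 _))
    have hmul := congrArg C (connectionCoeff_mul k (h1 _) (h2 _) (h3 _))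
    rw [C_add, C_add] at hadd
    rw [C_mul, C_mul] at hmul
    rw [hC.add_two (k + 2), hP.add_two (k + 1), ih, ih']
    linear_combination (-X * ultraspherical (lam + 1) (k + 1)) * hadd
      + ultraspherical (lam + 1) k * hmul + C (connectionCoeff lam (k + 2)) * hP.add_two k

lemma ultrasphericalCoeff_add_three (k : ℕ) (h0 : k + lam ≠ 0) (h1 : k + 1 + lam ≠ 0)
    (h2 : k + 2 + lam ≠ 0) :
    2 * (k + 2 + lam) * ultrasphericalCoeff lam (k + 3)
      = 1 + 2 * (k + lam) * ultrasphericalCoeff lam (k + 2) := by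
  rw [ultrasphericalCoeff_add_two lam (k + 1), ultrasphericalCoeff_add_two]
  push_cast
  rw [show (k : ℝ) + 1 + 1 + lam = k + 2 + lam by ring]
  field_simp
  ring

lemma X_sq_sub_one_mul_derivative_ultraspherical (hlam : ∀ k : ℕ, k + lam ≠ 0) (k : ℕ) :
    (X ^ 2 - 1) * derivative (ultraspherical lam k)
      = C (2 * (k + lam)) * ultraspherical lam (k + 1)
        - C (k + 2 * lam) * (X * ultraspherical lam k) := by
  have hC := isThreeTerm_ultraspherical lam
  have h1 (j : ℕ) : j + 1 + lam ≠ 0 := by exact_mod_cast hlam (j + 1)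
  have h2 (j : ℕ) : j + 2 + lam ≠ 0 := by exact_mod_cast hlam (j + 2)
  induction k using Nat.twoStepInduction with
  | zero => simp [hC.zero, hC.one]
  | one =>
    have h1' : 1 + lam ≠ 0 := by simpa using h1 0
    have hb : 2 * (1 + lam) * ultrasphericalCoeff lam 2 = 1 := by
      rw [ultrasphericalCoeff_two (by simpa using hlam 0),
        mul_one_div_cancel (mul_ne_zero two_ne_zero h1')]
    have hbC := congrArg C hb
    rw [hC.add_two, hC.one, hC.zero]
    simp only [C_mul, C_add, C_1, derivative_X, Nat.cast_one, mul_one, map_ofNat] at hbC ⊢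
    linear_combination hbC
  | more k ih ih' =>
    have hder := congrArg derivative (hC.add_two k)
    have hb := congrArg C (ultrasphericalCoeff_add_three k (hlam k) (h1 k) (h2 k))
    simp only [derivative_sub, derivative_mul, derivative_X, derivative_C] at hder
    push_cast at ih ih' ⊢
    simp only [C_mul, C_add, C_1, map_ofNat, map_natCast] at hb ih ih' ⊢
    rw [hC.add_two (k + 1)]
    linear_combination (X ^ 2 - 1) * hder + X * ih' - C (ultrasphericalCoeff lam (k + 2)) * ih
      + ultraspherical lam (k + 1) * hb + (X * (k + 2 * C lam)) * hC.add_two k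

lemma eval_derivative_ultraspherical (hlam : ∀ k : ℕ, k + lam ≠ 0) (k : ℕ) (x : ℝ) :
    (x ^ 2 - 1) * (ultraspherical lam k).derivative.eval x
      = 2 * (k + lam) * (ultraspherical lam (k + 1)).eval x
        - (k + 2 * lam) * (x * (ultraspherical lam k).eval x) := by
  simpa only [eval_mul, eval_sub, eval_pow, eval_X, eval_one, eval_C] using
    congrArg (eval x) (X_sq_sub_one_mul_derivative_ultraspherical hlam k)

lemma eval_one_ultraspherical_succ (hlam : ∀ k : ℕ, k + lam ≠ 0) (k : ℕ) :
    2 * (k + lam) * (ultraspherical lam (k + 1)).eval 1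
      = (k + 2 * lam) * (ultraspherical lam k).eval 1 := by
  linear_combination -eval_derivative_ultraspherical hlam k 1

lemma eval_one_ultraspherical_neg (hlam : lam ∈ Set.Ioo (-3 / 2 : ℝ) (-1 / 2))
    (hlam' : ∀ k : ℕ, k + lam ≠ 0) (k : ℕ) : (ultraspherical lam (k + 3)).eval 1 < 0 := by
  obtain ⟨hlower, hupper⟩ := hlam
  induction k with
  | zero =>
    have hone : (ultraspherical lam 1).eval 1 = 1 := by simp [ultraspherical]
    have htwo := eval_one_ultraspherical_succ hlam' 1
    have hthree := eval_one_ultraspherical_succ hlam' 2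
    push_cast at htwo hthree
    have hprod : (2 * (2 + lam)) * (ultraspherical lam 3).eval 1 = 1 + 2 * lam := by
      linear_combination hthree + htwo + (1 + 2 * lam) * hone
    exact (pos_iff_neg_of_mul_neg (hprod.trans_lt (by linarith))).1 (by linarith)
  | succ k ih =>
    have hstep := eval_one_ultraspherical_succ hlam' (k + 3)
    push_cast at hstep
    have hneg : (k + 3 + 2 * lam) * (ultraspherical lam (k + 3)).eval 1 < 0 :=
      mul_neg_of_pos_of_neg (by linarith [k.cast_nonneg (α := ℝ)]) ih
    exact (pos_iff_neg_of_mul_neg (hstep.trans_lt hneg)).1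
      (by linarith [k.cast_nonneg (α := ℝ)])

lemma hermiteBiehler_ultraspherical (hlam : -3 / 2 < lam) (hlam' : ∀ k : ℕ, k + lam ≠ 0) (k : ℕ) :
    HermiteBiehler (ultraspherical lam (k + 3)) (ultraspherical (lam + 1) (k + 2)) := by
  have hcoeff : ∀ j, 0 ≤ ultrasphericalCoeff (lam + 1) (j + 2) := fun j =>
    (ultrasphericalCoeff_pos (by linarith) (by simpa [add_comm] using hlam' 1) j).le
  have hconn : 0 ≤ connectionCoeff lam (k + 1) := connectionCoeff_nonneg (by
    push_cast
    linarith [k.cast_nonneg (α := ℝ)])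
  rw [ultraspherical_add_two_eq hlam' (k + 1)]
  exact ((isThreeTerm_ultraspherical _).hermiteBiehler hcoeff _).X_mul_sub_C_mul hconn

lemma eval_ultraspherical_succ_ne_zero (hlam : ∀ k : ℕ, k + 2 * lam ≠ 0) {k : ℕ} {x : ℝ}
    (hx : ((X ^ 2 - 1) * ultraspherical lam k).eval x = 0) :
    (ultraspherical lam (k + 1)).eval x ≠ 0 := by
  intro h0
  have hne : (ultraspherical lam k).eval x ≠ 0 :=
    (isThreeTerm_ultraspherical lam).eval_ne_zero_of_eval_succ_eq_zero
      (ultrasphericalCoeff_ne_zero hlam) h0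
  have hx1 : x ^ 2 - 1 = 0 := by simpa [hne] using hx
  have hstruct := eval_derivative_ultraspherical (add_natCast_ne_zero_of_two_mul hlam) k x
  have hx0 : x = 0 := by simpa [h0, hx1, hne, hlam k] using hstruct
  norm_num [hx0] at hx1

lemma eval_derivative_X_sq_sub_one_mul_ultraspherical (hlam : ∀ k : ℕ, k + lam ≠ 0) (k : ℕ)
    (x : ℝ) : ((X ^ 2 - 1) * ultraspherical lam k).derivative.eval x
      = 2 * (k + lam) * (ultraspherical lam (k + 1)).eval x
        + (2 - k - 2 * lam) * (x * (ultraspherical lam k).eval x) := by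
  have hprod : ((X ^ 2 - 1) * ultraspherical lam k).derivative.eval x
      = 2 * x * (ultraspherical lam k).eval x
        + (x ^ 2 - 1) * (ultraspherical lam k).derivative.eval x := by
    simp [one_add_one_eq_two]
  rw [hprod, eval_derivative_ultraspherical hlam]
  ring

lemma exists_pos_eval_derivative_eq (hlam : ∀ k : ℕ, k + lam ≠ 0) {k : ℕ} (hk : 0 < k + 2 * lam)
    {x : ℝ} (hx : ((X ^ 2 - 1) * ultraspherical lam k).eval x = 0) :
    ∃ r : ℝ, 0 < r ∧ ((X ^ 2 - 1) * ultraspherical lam k).derivative.eval x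
      = r * (ultraspherical lam (k + 1)).eval x := by
  have hk' : 0 < k + lam := by linarith [k.cast_nonneg (α := ℝ)]
  rw [eval_derivative_X_sq_sub_one_mul_ultraspherical hlam]
  simp only [eval_mul, eval_sub, eval_pow, eval_X, eval_one, mul_eq_zero] at hx
  rcases hx with hx | hx
  · have hstruct := eval_derivative_ultraspherical hlam k x
    rw [hx, zero_mul] at hstruct
    refine ⟨4 * (k + lam) / (k + 2 * lam), div_pos (mul_pos four_pos hk') hk, ?_⟩
    field_simp
    linear_combination (2 - k - 2 * lam) * hstruct
  · refine ⟨2 * (k + lam), by positivity, ?_⟩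
    rw [hx, mul_zero, mul_zero, add_zero]

lemma strictlyInterlaces_ultraspherical (hlam : ∀ k : ℕ, k + 2 * lam ≠ 0) {k : ℕ}
    (hk : 0 < k + 2 * lam) (hreal : ∀ z : ℂ, aeval z (ultraspherical lam k) = 0 → z.im = 0) :
    StrictlyInterlaces (ultraspherical lam (k + 1)) ((X ^ 2 - 1) * ultraspherical lam k) where
  im_eq_zero z hz := by
    simp only [map_mul, map_sub, map_pow, aeval_X, map_one, mul_eq_zero] at hz
    rcases hz with hz | hz
    · rcases sq_eq_one_iff.1 (sub_eq_zero.1 hz) with rfl | rfl <;> simp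
    · exact hreal z hz
  derivative_mul_pos x hx := by
    obtain ⟨r, hr, hder⟩ :=
      exists_pos_eval_derivative_eq (add_natCast_ne_zero_of_two_mul hlam) hk hx
    rw [hder, mul_assoc]
    exact mul_pos hr (mul_self_pos.2 (eval_ultraspherical_succ_ne_zero hlam hx))

lemma isGreatest_largestZero {p : ℝ[X]} (hp : p ≠ 0) (h : ∃ x, p.IsRoot x) :
    IsGreatest {x : ℝ | p.IsRoot x} (largestZero p) := by
  have hfin : {x : ℝ | p.IsRoot x}.Finite := finite_setOfPred_isRoot hp
  exact ⟨Set.Nonempty.csSup_mem h hfin, fun x hx => le_csSup hfin.bddAbove hx⟩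

lemma natCast_add_two_mul_ne_zero (hlam : lam ∈ Set.Ioo (-3 / 2 : ℝ) (-1 / 2)) (hlam1 : lam ≠ -1)
    (k : ℕ) : k + 2 * lam ≠ 0 := by
  obtain ⟨hlower, hupper⟩ := hlam
  intro h
  have hk1 : 1 < k := by exact_mod_cast (by linarith : (1 : ℝ) < k)
  have hk3 : k < 3 := by exact_mod_cast (by linarith : (k : ℝ) < 3)
  obtain rfl : k = 2 := by lia
  push_cast at h
  exact hlam1 (by linarith)

lemma isGreatest_largestZero_ultraspherical (hlam : lam ∈ Set.Ioo (-3 / 2 : ℝ) (-1 / 2))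
    (hlam1 : lam ≠ -1) (k : ℕ) :
    IsGreatest {x : ℝ | (ultraspherical lam (k + 3)).IsRoot x}
        (largestZero (ultraspherical lam (k + 3))) ∧
      1 < largestZero (ultraspherical lam (k + 3)) := by
  have hlam' := add_natCast_ne_zero_of_two_mul (natCast_add_two_mul_ne_zero hlam hlam1)
  have hmonic := ((isThreeTerm_ultraspherical lam).isMonicOfDegree (k + 3)).monic
  obtain ⟨x, hx1, hx⟩ :=
    exists_gt_isRoot_of_eval_neg hmonic (eval_one_ultraspherical_neg hlam hlam' k)
  have hgreatest := isGreatest_largestZero hmonic.ne_zero ⟨x, hx⟩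
  exact ⟨hgreatest, hx1.trans_le (hgreatest.2 hx)⟩

lemma lt_of_isRoot_X_sq_sub_one_mul {p : ℝ[X]} {a b x : ℝ}
    (hb : IsGreatest {x : ℝ | p.IsRoot x} b) (hb1 : 1 < b) (hba : b < a)
    (hx : ((X ^ 2 - 1) * p).IsRoot x) : x < a := by
  rcases root_mul.1 hx with hx | hx
  · have hx1 : x ^ 2 = 1 := by simpa [sub_eq_zero] using hx
    nlinarith
  · exact (hb.2 hx).trans_lt hba

lemma strictlyInterlaces_ultraspherical_add_four (hlam : lam ∈ Set.Ioo (-3 / 2 : ℝ) (-1 / 2))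
    (hlam1 : lam ≠ -1) (k : ℕ) : StrictlyInterlaces (ultraspherical lam (k + 4))
      ((X ^ 2 - 1) * ultraspherical lam (k + 3)) := by
  have hne := natCast_add_two_mul_ne_zero hlam hlam1
  refine strictlyInterlaces_ultraspherical hne ?_ fun z hz =>
    (hermiteBiehler_ultraspherical hlam.1 (add_natCast_ne_zero_of_two_mul hne) k).im_eq_zero hz
  push_cast
  linarith [hlam.1, k.cast_nonneg (α := ℝ)]

end Ultraspherical

section Wendroff

variable {n : ℕ} {lam a : ℝ} {ℓ : ℕ → ℝ} {k m : ℕ}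

lemma wendroffSeq_self : wendroffSeq n lam ℓ n = (X ^ 2 - 1) * ultraspherical lam (n - 2) := by
  simp [wendroffSeq, wendroffForward]

lemma wendroffSeq_succ_self : wendroffSeq (n + 1) lam ℓ n = ultraspherical lam n := by
  simp [wendroffSeq, wendroffBackward]

lemma wendroffSeq_of_le (hm : m ≤ n) :
    wendroffSeq n lam ℓ m = wendroffBackward n lam (n - m) := by
  rcases hm.lt_or_eq with h | rfl
  · simp [wendroffSeq, h]
  · simp [wendroffSeq, wendroffForward, wendroffBackward]

lemma wendroffSeq_add_two_of_lt (hm : n < m + 2) : wendroffSeq n lam ℓ (m + 2)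
    = X * wendroffSeq n lam ℓ (m + 1) - C (ℓ (m + 2)) * wendroffSeq n lam ℓ m := by
  rcases Nat.lt_or_ge m n with h | h
  · obtain rfl : n = m + 1 := by lia
    rw [wendroffSeq_self, wendroffSeq_succ_self, wendroffSeq, if_neg (by lia),
      show m + 2 - (m + 1) = 1 by lia, wendroffForward]
    rfl
  · obtain ⟨j, rfl⟩ := Nat.exists_eq_add_of_le h
    have hforward (i : ℕ) : wendroffSeq n lam ℓ (n + i) = wendroffForward n lam ℓ i := by
      simp [wendroffSeq]
    rw [add_assoc, add_assoc, hforward, hforward, hforward, wendroffForward]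
    rfl

lemma subsubleadingCoeff_sub_eq_coeff (A B : ℝ[X]) (m : ℕ) :
    subsubleadingCoeff (m + 1) B - subsubleadingCoeff (m + 2) A = (X * B - A).coeff m := by
  cases m with
  | zero => simp [subsubleadingCoeff]
  | succ m => simp [subsubleadingCoeff, coeff_X_mul]

lemma wendroffSeq_backward (hm : m + 2 ≤ n) : wendroffSeq n lam ℓ m
    = C ((X * wendroffSeq n lam ℓ (m + 1) - wendroffSeq n lam ℓ (m + 2)).coeff m)⁻¹
      * (X * wendroffSeq n lam ℓ (m + 1) - wendroffSeq n lam ℓ (m + 2)) := by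
  obtain ⟨i, rfl⟩ := Nat.exists_eq_add_of_le hm
  rw [wendroffSeq_of_le (m := m) (by lia), wendroffSeq_of_le (m := m + 1) (by lia),
    wendroffSeq_of_le hm, show m + 2 + i - m = i + 2 by lia,
    show m + 2 + i - (m + 1) = i + 1 by lia, show m + 2 + i - (m + 2) = i by lia,
    wendroffBackward, show m + 2 + i - i - 1 = m + 1 by lia, show m + 2 + i - i = m + 2 by lia,
    subsubleadingCoeff_sub_eq_coeff, one_div]
  ring

lemma admissibleAt_iff (hm : n < m + 2) : AdmissibleAt n lam a ℓ (m + 2 - n)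
    ↔ ℓ (m + 2) ∈ Set.Ioo 0
      (a * (wendroffSeq n lam ℓ (m + 1)).eval a / (wendroffSeq n lam ℓ m).eval a) := by
  rw [AdmissibleAt, Nat.add_sub_of_le hm.le]
  rfl

lemma isMonicOfDegree_X_sq_sub_one_mul_ultraspherical (lam : ℝ) (k : ℕ) :
    IsMonicOfDegree ((X ^ 2 - 1) * ultraspherical lam k) (k + 2) := by
  rw [add_comm]
  exact ((isMonicOfDegree_X_pow ℝ 2).sub (by simp)).mul
    ((isThreeTerm_ultraspherical lam).isMonicOfDegree k)

lemma posDefBelow_gaussFunctional_ultraspherical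
    (h : StrictlyInterlaces (ultraspherical lam (k + 1)) ((X ^ 2 - 1) * ultraspherical lam k)) :
    PosDefBelow (gaussFunctional ((X ^ 2 - 1) * ultraspherical lam k)
      (ultraspherical lam (k + 1))) (k + 2) := by
  have hA := isMonicOfDegree_X_sq_sub_one_mul_ultraspherical lam k
  simpa only [hA.natDegree_eq] using h.posDefBelow_gaussFunctional hA.ne_zero

lemma isSymmOrthogonal_ultraspherical_succ
    (h : StrictlyInterlaces (ultraspherical lam (k + 1)) ((X ^ 2 - 1) * ultraspherical lam k)) :
    IsSymmOrthogonal (gaussFunctional ((X ^ 2 - 1) * ultraspherical lam k)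
      (ultraspherical lam (k + 1))) (k + 1) (ultraspherical lam (k + 1)) where
  isMonicOfDegree := (isThreeTerm_ultraspherical lam).isMonicOfDegree _
  hasParity := (isThreeTerm_ultraspherical lam).hasParity _
  orthogonalBelow :=
    h.orthogonalBelow_gaussFunctional (isMonicOfDegree_X_sq_sub_one_mul_ultraspherical lam k)

lemma isSymmOrthogonal_X_sq_sub_one_mul_ultraspherical (lam : ℝ) (k : ℕ) :
    IsSymmOrthogonal (gaussFunctional ((X ^ 2 - 1) * ultraspherical lam k)
      (ultraspherical lam (k + 1))) (k + 2) ((X ^ 2 - 1) * ultraspherical lam k) where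
  isMonicOfDegree := isMonicOfDegree_X_sq_sub_one_mul_ultraspherical lam k
  hasParity := by
    have hC := (isThreeTerm_ultraspherical lam).hasParity k
    rw [sub_mul, one_mul, pow_two, mul_assoc]
    exact hC.X_mul.X_mul.sub hC.add_two
  orthogonalBelow := orthogonalBelow_gaussFunctional_self _ _ _

lemma isSymmOrthogonal_wendroffSeq
    (h : StrictlyInterlaces (ultraspherical lam (k + 1)) ((X ^ 2 - 1) * ultraspherical lam k))
    (hm : m ≤ k + 2) :
    IsSymmOrthogonal (gaussFunctional ((X ^ 2 - 1) * ultraspherical lam k)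
      (ultraspherical lam (k + 1))) m (wendroffSeq (k + 2) lam ℓ m) := by
  have hself := isSymmOrthogonal_X_sq_sub_one_mul_ultraspherical lam k
  have hpred := isSymmOrthogonal_ultraspherical_succ h
  have hL := posDefBelow_gaussFunctional_ultraspherical h
  set L := gaussFunctional ((X ^ 2 - 1) * ultraspherical lam k) (ultraspherical lam (k + 1))
  rw [← wendroffSeq_succ_self (ℓ := ℓ)] at hpred
  replace hself : IsSymmOrthogonal L (k + 2) (wendroffSeq (k + 2) lam ℓ (k + 2)) := by
    rwa [wendroffSeq_self]
  suffices hboth : ∀ j ≤ k + 1, IsSymmOrthogonal L j (wendroffSeq (k + 2) lam ℓ j) ∧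
      IsSymmOrthogonal L (j + 1) (wendroffSeq (k + 2) lam ℓ (j + 1)) by
    rcases hm.lt_or_eq with hlt | rfl
    · exact (hboth m (by lia)).1
    · exact hself
  intro j hj
  induction hj using Nat.decreasingInduction with
  | self => exact ⟨hpred, hself⟩
  | of_succ j hj ih =>
    refine ⟨?_, ih.1⟩
    rw [wendroffSeq_backward (by lia)]
    exact ih.2.backward ih.1 (ih.2.coeff_X_mul_sub_pos ih.1 hL (by lia)).ne'

/-- The coefficients `ℓ_{k+2}` of the recurrence that the whole sequence `D_m` satisfies: those of
the backward recurrence up to `ℓ_n`, and the chosen ones from there on. -/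
noncomputable def wendroffCoeff (n : ℕ) (lam : ℝ) (ℓ : ℕ → ℝ) (k : ℕ) : ℝ :=
  if k + 2 ≤ n then subsubleadingCoeff (k + 1) (wendroffSeq n lam ℓ (k + 1))
    - subsubleadingCoeff (k + 2) (wendroffSeq n lam ℓ (k + 2)) else ℓ (k + 2)

lemma wendroffCoeff_pos_of_le
    (h : StrictlyInterlaces (ultraspherical lam (k + 1)) ((X ^ 2 - 1) * ultraspherical lam k))
    (hm : m ≤ k) : 0 < wendroffCoeff (k + 2) lam ℓ m := by
  rw [wendroffCoeff, if_pos (by lia), subsubleadingCoeff_sub_eq_coeff]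
  exact (isSymmOrthogonal_wendroffSeq h (by lia)).coeff_X_mul_sub_pos
    (isSymmOrthogonal_wendroffSeq h (by lia)) (posDefBelow_gaussFunctional_ultraspherical h)
    (by lia)

lemma wendroffCoeff_pos
    (h : StrictlyInterlaces (ultraspherical lam (k + 1)) ((X ^ 2 - 1) * ultraspherical lam k))
    (hadm : ∀ j, 1 ≤ j → AdmissibleAt (k + 2) lam a ℓ j) (m : ℕ) :
    0 < wendroffCoeff (k + 2) lam ℓ m := by
  rcases Nat.lt_or_ge k m with hm | hm
  · rw [wendroffCoeff, if_neg (by lia)]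
    exact ((admissibleAt_iff (by lia)).1 (hadm _ (by lia))).1
  · exact wendroffCoeff_pos_of_le h hm

lemma isThreeTerm_wendroffSeq
    (h : StrictlyInterlaces (ultraspherical lam (k + 1)) ((X ^ 2 - 1) * ultraspherical lam k)) :
    IsThreeTerm (wendroffCoeff (k + 2) lam ℓ) (wendroffSeq (k + 2) lam ℓ) where
  zero := isMonicOfDegree_zero_iff.1 (isSymmOrthogonal_wendroffSeq h (by lia)).isMonicOfDegree
  one := by
    have hone := isSymmOrthogonal_wendroffSeq (ℓ := ℓ) h (m := 1) (by lia)
    obtain ⟨c, hc⟩ := isMonicOfDegree_one_iff.1 hone.isMonicOfDegree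
    have hcoeff := hone.hasParity.coeff_eq_zero (j := 0) (by decide)
    rw [hc] at hcoeff ⊢
    simpa using hcoeff
  add_two m := by
    rcases Nat.lt_or_ge k m with hm | hm
    · rw [wendroffCoeff, if_neg (by lia)]
      exact wendroffSeq_add_two_of_lt (by lia)
    · have hne := (wendroffCoeff_pos_of_le (ℓ := ℓ) h hm).ne'
      have hback := wendroffSeq_backward (lam := lam) (ℓ := ℓ) (show m + 2 ≤ k + 2 by lia)
      rw [← subsubleadingCoeff_sub_eq_coeff] at hback
      rw [wendroffCoeff, if_pos (by lia)] at hne ⊢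
      rw [hback, ← mul_assoc, ← C_mul, mul_inv_cancel₀ hne, C_1, one_mul, sub_sub_cancel]

lemma eval_wendroffSeq_pos_of_le
    (h : StrictlyInterlaces (ultraspherical lam (k + 1)) ((X ^ 2 - 1) * ultraspherical lam k))
    (ha : ∀ x, ((X ^ 2 - 1) * ultraspherical lam k).IsRoot x → x < a) (hm : m ≤ k + 2) :
    0 < (wendroffSeq (k + 2) lam ℓ m).eval a := by
  have hA := isMonicOfDegree_X_sq_sub_one_mul_ultraspherical lam k
  have hD := isSymmOrthogonal_wendroffSeq (ℓ := ℓ) h hm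
  refine hD.orthogonalBelow.eval_pos_of_forall_lt (fun x hx => h.gaussWeight_pos hx)
    hD.isMonicOfDegree ?_ fun x hx => ha x (isRoot_of_mem_roots (Multiset.mem_toFinset.1 hx))
  rwa [h.card_toFinset_roots hA.ne_zero, hA.natDegree_eq]

lemma eval_wendroffSeq_pos
    (h : StrictlyInterlaces (ultraspherical lam (k + 1)) ((X ^ 2 - 1) * ultraspherical lam k))
    (ha : ∀ x, ((X ^ 2 - 1) * ultraspherical lam k).IsRoot x → x < a) {i : ℕ}
    (hadm : ∀ j, 1 ≤ j → j < i → AdmissibleAt (k + 2) lam a ℓ j) (hm : m < k + 2 + i) :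
    0 < (wendroffSeq (k + 2) lam ℓ m).eval a := by
  induction m using Nat.twoStepInduction with
  | zero => exact eval_wendroffSeq_pos_of_le h ha (by lia)
  | one => exact eval_wendroffSeq_pos_of_le h ha (by lia)
  | more m ih _ =>
    rcases Nat.lt_or_ge k m with hk | hk
    · have hlt := ((admissibleAt_iff (by lia)).1 (hadm (m + 2 - (k + 2)) (by lia) (by lia))).2
      rw [lt_div_iff₀ (ih (by lia))] at hlt
      rw [wendroffSeq_add_two_of_lt (by lia)]
      simpa using hlt
    · exact eval_wendroffSeq_pos_of_le h ha (by lia)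

end Wendroff

theorem theorem3p1 (n : ℕ) (hn : 5 ≤ n) (lam : ℝ) (hlam : lam ∈ Set.Ioo (-3 / 2 : ℝ) (-1 / 2))
    (hlam1 : lam ≠ -1) (ε : ℝ) (hε : 0 < ε) (a : ℝ)
    (ha : a = largestZero (ultraspherical lam (n - 2)) + ε) :
    -- the number `a` is well defined
    (IsGreatest {x : ℝ | (ultraspherical lam (n - 2)).IsRoot x}
        (largestZero (ultraspherical lam (n - 2))) ∧
      1 < largestZero (ultraspherical lam (n - 2))) ∧
    -- the forward coefficients can be chosen one after the other
    (∀ (ℓ : ℕ → ℝ) (k : ℕ), 1 ≤ k → (∀ j, 1 ≤ j → j < k → AdmissibleAt n lam a ℓ j) →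
      0 < a * (wendroffSeq n lam ℓ (n + k - 1)).eval a
        / (wendroffSeq n lam ℓ (n + k - 2)).eval a) ∧
    -- the result, for every admissible choice of the forward coefficients
    (∀ ℓ : ℕ → ℝ, (∀ j, 1 ≤ j → AdmissibleAt n lam a ℓ j) →
      -- the coefficients of the backward recurrence are positive
      (∀ m, 2 ≤ m → m ≤ n →
        0 < subsubleadingCoeff (m - 1) (wendroffSeq n lam ℓ (m - 1))
          - subsubleadingCoeff m (wendroffSeq n lam ℓ m)) ∧
      -- symmetry
      (∀ m, (wendroffSeq n lam ℓ m).comp (-X) = (-1) ^ m * wendroffSeq n lam ℓ m) ∧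
      -- orthogonality
      (∃ μ : Measure ℝ, μ (Set.Icc (-a) a)ᶜ = 0 ∧ IsMonicOrthogonal (wendroffSeq n lam ℓ) μ) ∧
      -- all complex zeros are real and lie in the open interval
      (∀ (m : ℕ) (z : ℂ), aeval z (wendroffSeq n lam ℓ m) = 0 →
        ∃ x : ℝ, x ∈ Set.Ioo (-a) a ∧ z = (x : ℂ))) := by
  obtain ⟨k, rfl⟩ : ∃ k, n = k + 5 := ⟨n - 5, by lia⟩
  obtain ⟨hgreatest, hlarge⟩ := isGreatest_largestZero_ultraspherical hlam hlam1 k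
  have hinter := strictlyInterlaces_ultraspherical_add_four hlam hlam1 k
  rw [show k + 5 - 2 = k + 3 from rfl] at ha ⊢
  have hroots (x : ℝ) (hx : ((X ^ 2 - 1) * ultraspherical lam (k + 3)).IsRoot x) : x < a :=
    lt_of_isRoot_X_sq_sub_one_mul hgreatest hlarge (by linarith) hx
  refine ⟨⟨hgreatest, hlarge⟩, fun ℓ i _ hadm => ?_, fun ℓ hadm => ?_⟩
  · have hpos {m : ℕ} (hm : m < k + 5 + i) := eval_wendroffSeq_pos hinter hroots hadm hm
    exact div_pos (mul_pos (by linarith) (hpos (by lia))) (hpos (by lia))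
  · have hD := isThreeTerm_wendroffSeq (ℓ := ℓ) hinter
    have hc := wendroffCoeff_pos hinter hadm
    have hpos (m : ℕ) : 0 < (wendroffSeq (k + 5) lam ℓ m).eval a :=
      eval_wendroffSeq_pos (i := m + 1) hinter hroots (fun j hj _ => hadm j hj) (by lia)
    refine ⟨fun m hm2 hmn => ?_, hD.hasParity, hD.exists_isMonicOrthogonal hc hpos,
      fun m z hz => hD.exists_mem_Ioo_of_aeval_eq_zero (fun j => (hc j).le) hpos hz⟩
    obtain ⟨j, rfl⟩ := Nat.exists_eq_add_of_le' hm2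
    exact (hc j).trans_eq (if_pos hmn)
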